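/- Let $\Gamma\subseteq\mathbb{R}^d$ be a Borel set and let $\mu$ be a Borel probability measure on $\Gamma$ that is absolutely continuous with respect to Lebesgue measure. Let $(\psi_j)_{j\ge 1}$ be measurable real functions on $\Gamma$ that form an orthonormal basis of $L^2(\Gamma,\mu)$, with $\psi_1\equiv 1$ on $\Gamma$. Fix $n\ge 1$ and put $$w(x):=n\Big(\sum_{j=1}^n|\psi_j(x)|^2\Big)^{-1}\quad(x\in\Gamma),\qquad d\sigma:=w^{-1}\,d\mu ,$$ so that $\sigma$ is a probability measure on $\Gamma$. Let $y_1,y_2,\dots$ be independent random points of $\Gamma$, defined on a common probability space, each with law $\sigma$. For $m\ge 1$ let $D^m\in\mathbb{R}^{m\times n}$ be the matrix with entries $D^m_{ik}:=\sqrt{w(y_i)}\,\psi_k(y_i)$ and rows $D^m_i$, let $G^m:=\frac1m (D^m)^\top D^m\in\mathbb{R}^{n\times n}$ and $e_1:=(1,0,\dots,0)^\top\in\mathbb{R}^n$, and define the cubature weights $$\alpha_{i,m}:=\frac1m\sqrt{w(y_i)}\;D^m_i\,(G^m)^{-1}e_1,\qquad i=1,\dots,m$$ (where $G^m$ is singular,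 $(G^m)^{-1}$ is given the value $0$). Let $\delta\in(0,1)$ and $r>0$, put $\xi(\delta):=(1+\delta)\ln(1+\delta)-\delta$, and let $\overline m\ge 2$ be an integer with $$\frac{\overline m}{\ln\overline m}\ \ge\ \frac{1+r}{\xi(\delta)}\,n .$$ Then for every integer $i\ge 1$, almost surely, $G^m$ is invertible for all sufficiently large $m$, and the sequence $(m\,\alpha_{i,m})_{m\ge\max\{i,\overline m\}}$ converges to $w(y_i)$ as $m\to\infty$. -/

import Mathlib

open MeasureTheory ProbabilityTheory Filter Topology

namespace RandomizedCubature

noncomputable section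

variable {X : Type*}

/-- The function `κ(x) = (∑_{j=1}^n ψ_j(x)²)⁻¹`; the functions `ψ_1, ψ_2, …` of the text are
`ψ 0, ψ 1, …` here. -/
def kappa (ψ : ℕ → X → ℝ) (n : ℕ) (x : X) : ℝ :=
  (∑ j : Fin n, |ψ j x| ^ 2)⁻¹

/-- The weight function `w = n κ`. -/
def weight (ψ : ℕ → X → ℝ) (n : ℕ) (x : X) : ℝ :=
  n * kappa ψ n x

/-- The sampling measure `dσ = w⁻¹ dμ`. -/
def samplingMeasure [MeasurableSpace X] (μ : Measure X) (ψ : ℕ → X → ℝ) (n : ℕ) : Measure X :=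
  μ.withDensity fun x => ENNReal.ofReal (weight ψ n x)⁻¹

/-- The `m × n` design matrix of the first `m` nodes, `D_{ik} = √(w(y_i)) ψ_k(y_i)`. -/
def designMatrix (ψ : ℕ → X → ℝ) (n m : ℕ) (y : ℕ → X) : Matrix (Fin m) (Fin n) ℝ :=
  Matrix.of fun i k => √(weight ψ n (y i)) * ψ k (y i)

/-- The Gramian matrix `G = (1/m) Dᵀ D`. -/
def gramian (ψ : ℕ → X → ℝ) (n m : ℕ) (y : ℕ → X) : Matrix (Fin n) (Fin n) ℝ :=
  (1 / (m : ℝ)) • ((designMatrix ψ n m y).transpose * designMatrix ψ n m y)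

/-- The first coordinate vector `e_1 = (1, 0, …, 0)` of `ℝⁿ`. -/
def firstVec (n : ℕ) : Fin n → ℝ :=
  fun k => if (k : ℕ) = 0 then 1 else 0

/-- The cubature weights `α_{i,m} = (1/m) √(w(y_i)) D_i G⁻¹ e_1`, with `D_i` the `i`-th row
of the design matrix. -/
def cubatureWeight (ψ : ℕ → X → ℝ) (n m : ℕ) (y : ℕ → X) (i : Fin m) : ℝ :=
  1 / (m : ℝ) * √(weight ψ n (y i)) *
    (designMatrix ψ n m y i ⬝ᵥ ((gramian ψ n m y)⁻¹).mulVec (firstVec n))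

/-- `ξ(δ) = (1 + δ) ln (1 + δ) - δ`. -/
def xi (δ : ℝ) : ℝ :=
  (1 + δ) * Real.log (1 + δ) - δ

/-- The condition `m / ln m ≥ ((1 + r) / ξ(δ)) n` on the number of nodes. -/
def SampleSizeCondition (m n : ℕ) (δ r : ℝ) : Prop :=
  (1 + r) / xi δ * n ≤ (m : ℝ) / Real.log m

end

end RandomizedCubature

namespace RandomizedCubature

section Weight

variable {X : Type*} {ψ : ℕ → X → ℝ} {n : ℕ}

/-! Each entry of the Gramian is an empirical mean of `w ψ_j ψ_k` over i.i.d. nodes of law `σ`. The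
factor `w` cancels the density of `σ`, so its expectation is `∫ ψ_j ψ_k dμ = δ_jk`, and the strong
law gives `G → 1` almost surely (`tendsto_gramian`). Determinant and inverse are continuous at `1`,
so `G` is eventually invertible and `G⁻¹ → 1`. By `nat_mul_cubatureWeight`, `m α_{i,m}` is a
continuous function of `G⁻¹`, whose value at `1` is `w(y_i) ψ_0(y_i) = w(y_i)`. -/

lemma kappa_pos (hψ_one : ∀ x, ψ 0 x = 1) (hn : 1 ≤ n) (x : X) : 0 < kappa ψ n x := by
  refine inv_pos.2 (lt_of_lt_of_le one_pos ?_)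
  have h := Finset.single_le_sum (f := fun j : Fin n => |ψ j x| ^ 2)
    (fun j _ => by positivity) (Finset.mem_univ (⟨0, hn⟩ : Fin n))
  simpa [hψ_one] using h

lemma weight_pos (hψ_one : ∀ x, ψ 0 x = 1) (hn : 1 ≤ n) (x : X) : 0 < weight ψ n x :=
  mul_pos (by exact_mod_cast hn) (kappa_pos hψ_one hn x)

lemma measurable_weight [MeasurableSpace X] (hψ : ∀ j, Measurable (ψ j)) :
    Measurable (weight ψ n) := by
  unfold weight kappa
  fun_prop

lemma measurable_samplingDensity [MeasurableSpace X] (hψ : ∀ j, Measurable (ψ j)) :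
    Measurable fun x => ENNReal.ofReal (weight ψ n x)⁻¹ :=
  (measurable_weight hψ).inv.ennreal_ofReal

/-- Integrating `w g` against `σ` is integrating `g` against `μ`. -/
lemma integral_weight_mul_samplingMeasure [MeasurableSpace X] {μ : Measure X}
    (hψ : ∀ j, Measurable (ψ j)) (hψ_one : ∀ x, ψ 0 x = 1) (hn : 1 ≤ n) (g : X → ℝ) :
    ∫ x, weight ψ n x * g x ∂samplingMeasure μ ψ n = ∫ x, g x ∂μ := by
  rw [samplingMeasure, integral_withDensity_eq_integral_toReal_smul
    (measurable_samplingDensity hψ) (by simp)]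
  refine integral_congr_ae (.of_forall fun x => ?_)
  have hw := weight_pos hψ_one hn x
  simp [ENNReal.toReal_ofReal (inv_pos.2 hw).le, hw.ne']

lemma integrable_weight_mul_samplingMeasure [MeasurableSpace X] {μ : Measure X}
    (hψ : ∀ j, Measurable (ψ j)) (hψ_one : ∀ x, ψ 0 x = 1) (hn : 1 ≤ n) {g : X → ℝ}
    (hg : Integrable g μ) :
    Integrable (fun x => weight ψ n x * g x) (samplingMeasure μ ψ n) := by
  rw [samplingMeasure, integrable_withDensity_iff_integrable_smul'
    (measurable_samplingDensity hψ) (by simp)]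
  refine hg.congr (.of_forall fun x => ?_)
  have hw := weight_pos hψ_one hn x
  simp [ENNReal.toReal_ofReal (inv_pos.2 hw).le, hw.ne']

lemma gramian_apply (hψ_one : ∀ x, ψ 0 x = 1) (hn : 1 ≤ n) (m : ℕ) (y : ℕ → X) (j k : Fin n) :
    gramian ψ n m y j k =
      (∑ i ∈ Finset.range m, weight ψ n (y i) * (ψ j (y i) * ψ k (y i))) / m := by
  rw [Finset.sum_range, div_eq_inv_mul]
  simp only [gramian, designMatrix, Matrix.smul_apply, Matrix.mul_apply, Matrix.transpose_apply,
    Matrix.of_apply, smul_eq_mul, one_div]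
  congr 1
  refine Finset.sum_congr rfl fun i _ => ?_
  rw [mul_mul_mul_comm, Real.mul_self_sqrt (weight_pos hψ_one hn _).le]

/-- The two factors `√w`, one explicit and one in the row of the design matrix, combine to `w`. What
remains depends on `m` only through the inverse Gramian. -/
lemma nat_mul_cubatureWeight (hψ_one : ∀ x, ψ 0 x = 1) (hn : 1 ≤ n) {m : ℕ} (y : ℕ → X)
    (i : Fin m) :
    (m : ℝ) * cubatureWeight ψ n m y i = weight ψ n (y i) *
      ((fun k : Fin n => ψ k (y i)) ⬝ᵥ ((gramian ψ n m y)⁻¹).mulVec (firstVec n)) := by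
  have hm : (m : ℝ) ≠ 0 := by exact_mod_cast (i.pos).ne'
  have hD : designMatrix ψ n m y i = √(weight ψ n (y i)) • fun k : Fin n => ψ k (y i) := by
    ext k; simp [designMatrix]
  rw [cubatureWeight, hD, smul_dotProduct, smul_eq_mul]
  nth_rewrite 3 [← Real.mul_self_sqrt (weight_pos hψ_one hn (y i)).le]
  field_simp

end Weight

section StrongLaw

variable {X Ω : Type*} [MeasurableSpace X] [MeasurableSpace Ω] {μ : Measure X} {P : Measure Ω}
  {ψ : ℕ → X → ℝ} {n : ℕ}

lemma integrable_mul_of_hilbertBasis (b : HilbertBasis ℕ ℝ (Lp ℝ 2 μ))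
    (hb : ∀ j, b j =ᵐ[μ] ψ j) (j k : ℕ) : Integrable (fun x => ψ j x * ψ k x) μ :=
  ((memLp_congr_ae (hb j)).1 (Lp.memLp (b j))).integrable_mul
    ((memLp_congr_ae (hb k)).1 (Lp.memLp (b k)))

lemma integral_mul_of_hilbertBasis (b : HilbertBasis ℕ ℝ (Lp ℝ 2 μ))
    (hb : ∀ j, b j =ᵐ[μ] ψ j) (j k : ℕ) :
    ∫ x, ψ j x * ψ k x ∂μ = if j = k then 1 else 0 := by
  rw [← orthonormal_iff_ite.1 b.orthonormal j k, L2.inner_def]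
  refine integral_congr_ae ?_
  filter_upwards [hb j, hb k] with x hj hk
  simp [hj, hk, mul_comm]

/-- The Gramian matrices converge almost surely to the identity matrix. -/
lemma tendsto_gramian (hψ : ∀ j, Measurable (ψ j)) (b : HilbertBasis ℕ ℝ (Lp ℝ 2 μ))
    (hb : ∀ j, b j =ᵐ[μ] ψ j) (hψ_one : ∀ x, ψ 0 x = 1) (hn : 1 ≤ n)
    {y : ℕ → Ω → X} (hy_indep : iIndepFun y P)
    (hy_law : ∀ i, HasLaw (y i) (samplingMeasure μ ψ n) P) :
    ∀ᵐ ω ∂P, Tendsto (fun m => gramian ψ n m fun k => y k ω) atTop (𝓝 1) := by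
  have key : ∀ j k : Fin n, ∀ᵐ ω ∂P,
      Tendsto (fun m => gramian ψ n m (fun k => y k ω) j k) atTop
        (𝓝 ((1 : Matrix (Fin n) (Fin n) ℝ) j k)) := by
    intro j k
    set f : X → ℝ := fun x => weight ψ n x * (ψ j x * ψ k x) with hf
    have hfm : Measurable f := (measurable_weight hψ).mul ((hψ j).mul (hψ k))
    have hint : Integrable (f ∘ y 0) P := by
      refine Integrable.comp_aemeasurable ?_ (hy_law 0).aemeasurable
      rw [(hy_law 0).map_eq]
      exact integrable_weight_mul_samplingMeasure hψ hψ_one hn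
        (integrable_mul_of_hilbertBasis b hb j k)
    have hmean : ∫ ω, (f ∘ y 0) ω ∂P = (1 : Matrix (Fin n) (Fin n) ℝ) j k := by
      rw [(hy_law 0).integral_comp hfm.aestronglyMeasurable,
        integral_weight_mul_samplingMeasure hψ hψ_one hn, integral_mul_of_hilbertBasis b hb,
        Matrix.one_apply]
      simp [Fin.ext_iff]
    have hlaw := strong_law_ae_real (fun i => f ∘ y i) hint
      -- Pairwise independence suffices for this strong law.
      (fun i i' hii' => (hy_indep.indepFun hii').comp hfm hfm)
      (fun i => ((hy_law i).identDistrib (hy_law 0)).comp hfm)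
    filter_upwards [hlaw] with ω hω
    rw [hmean] at hω
    simpa only [gramian_apply hψ_one hn, Function.comp_apply, hf] using hω
  -- There are finitely many entries, so one null set serves all of them.
  filter_upwards [ae_all_iff.2 fun j => ae_all_iff.2 (key j)] with ω hω
  exact tendsto_pi_nhds.2 fun j => tendsto_pi_nhds.2 (hω j)

end StrongLaw

lemma dotProduct_firstVec {n : ℕ} (hn : 1 ≤ n) (v : Fin n → ℝ) :
    v ⬝ᵥ firstVec n = v ⟨0, hn⟩ := by
  rw [dotProduct, Finset.sum_eq_single ⟨0, hn⟩]
  · simp [firstVec]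
  · intro k _ hk
    have : (k : ℕ) ≠ 0 := fun h => hk (Fin.ext h)
    simp [firstVec, this]
  · simp

end RandomizedCubature

theorem mainTheorem4
    {d : ℕ} (Γ : Set (EuclideanSpace ℝ (Fin d))) (hΓ : MeasurableSet Γ)
    (μ : Measure Γ) [IsProbabilityMeasure μ] (hμ : μ.map Subtype.val ≪ volume)
    -- an orthonormal basis of `L²(Γ, μ)` by functions on `Γ`, the first of them constant `1`
    (ψ : ℕ → Γ → ℝ) (hψ : ∀ j, Measurable (ψ j))
    (b : HilbertBasis ℕ ℝ (Lp ℝ 2 μ)) (hb : ∀ j, b j =ᵐ[μ] ψ j)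
    (hψ_one : ∀ x, ψ 0 x = 1)
    (n : ℕ) (hn : 1 ≤ n)
    -- the nodes: independent, each with law `σ`
    {Ω : Type*} [MeasurableSpace Ω] (P : Measure Ω) [IsProbabilityMeasure P]
    (y : ℕ → Ω → Γ) (hy_indep : iIndepFun y P)
    (hy_law : ∀ i, HasLaw (y i) (RandomizedCubature.samplingMeasure μ ψ n) P)
    (δ r : ℝ) (hδ : δ ∈ Set.Ioo (0 : ℝ) 1) (hr : 0 < r)
    (mbar : ℕ) (hmbar : RandomizedCubature.SampleSizeCondition mbar n δ r)
    (i : ℕ) :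
    ∀ᵐ ω ∂P,
      (∀ᶠ m : ℕ in atTop, IsUnit (RandomizedCubature.gramian ψ n m fun k => y k ω).det) ∧
      Tendsto
        (fun m : Set.Ici (max (i + 1) mbar) =>
          ((m : ℕ) : ℝ) * RandomizedCubature.cubatureWeight ψ n m (fun k => y k ω)
            ⟨i, (le_max_left (i + 1) mbar).trans m.2⟩)
        atTop (𝓝 (RandomizedCubature.weight ψ n (y i ω))) := by

  filter_upwards [RandomizedCubature.tendsto_gramian hψ b hb hψ_one hn hy_indep hy_law]
    with ω hG
  have hdet : Tendsto (fun m => (RandomizedCubature.gramian ψ n m fun k => y k ω).det) atTop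
      (𝓝 1) := by
    simpa [Function.comp_def] using
      ((continuous_id.matrix_det (n := Fin n) (R := ℝ)).tendsto 1).comp hG
  refine ⟨(hdet.eventually_ne one_ne_zero).mono fun m hm => hm.isUnit, ?_⟩
  have hinv : Tendsto (fun m => (RandomizedCubature.gramian ψ n m fun k => y k ω)⁻¹) atTop
      (𝓝 1) := by
    have hc : ContinuousAt Inv.inv (1 : Matrix (Fin n) (Fin n) ℝ) := by
      -- Only continuity of the scalar inverse at `det 1 = 1` is needed.
      refine continuousAt_matrix_inv _ ?_
      rw [Matrix.det_one, Ring.inverse_eq_inv']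
      exact continuousAt_inv₀ one_ne_zero
    simpa [Function.comp_def] using hc.tendsto.comp hG
  have hlim : Tendsto (fun m => RandomizedCubature.weight ψ n (y i ω) *
      ((fun k : Fin n => ψ k (y i ω)) ⬝ᵥ
        ((RandomizedCubature.gramian ψ n m fun k => y k ω)⁻¹).mulVec
          (RandomizedCubature.firstVec n))) atTop
      (𝓝 (RandomizedCubature.weight ψ n (y i ω))) := by
    have hc : Continuous fun A : Matrix (Fin n) (Fin n) ℝ =>
        RandomizedCubature.weight ψ n (y i ω) *
          ((fun k : Fin n => ψ k (y i ω)) ⬝ᵥ A.mulVec (RandomizedCubature.firstVec n)) :=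
      continuous_const.mul
        (continuous_const.dotProduct (continuous_id.matrix_mulVec continuous_const))
    have h := (hc.tendsto 1).comp hinv
    rwa [Matrix.one_mulVec, RandomizedCubature.dotProduct_firstVec hn, hψ_one, mul_one] at h
  -- Nodes are numbered from `0`, so `m ≥ i + 1` makes `i` a valid index; restricting to this tail
  -- keeps the limit.
  refine (hlim.comp (tendsto_comp_val_Ici_atTop.2 tendsto_id)).congr fun m => ?_
  exact (RandomizedCubature.nat_mul_cubatureWeight hψ_one hn (fun k => y k ω)
    ⟨i, (le_max_left (i + 1) mbar).trans m.2⟩).symm
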